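/- All vector spaces are over $\mathbb{C}$. Let $(V,Y,\mathbf 1,\omega)$ be a vertex operator algebra, $Y(a,z)=\sum_{n\in\mathbb Z}a_nz^{-n-1}$, $L(n)=\omega_{n+1}$; thus $V=\bigoplus_{n\in\mathbb Z}V_n$ with $V_n=\{a\in V: L(0)a=na\}$ finite-dimensional and $V_n=0$ for all sufficiently small $n$. A weak $V$-module is a vector space $M$ with a linear map $a\mapsto Y_M(a,z)=\sum_{n\in\mathbb Z}a_nz^{-n-1}$, $a_n\in\operatorname{End}M$, such that $a_nw=0$ for $n\gg0$ (for all $a\in V$, $w\in M$), $Y_M(\mathbf 1,z)=\mathrm{id}_M$, and the Jacobi identity holds. A (weak) submodule is a subspace stable under all $a_n$. A $V$-module is a weak $V$-module $M$ with $M=\bigoplus_{\lambda\in\mathbb C}M_\lambda$, $M_\lambda=\{w\in M: L(0)w=\lambda w\}$, such that every $M_\lambda$ is finite-dimensional and, for each fixed $\lambda$, $M_{\lambda+n}=0$ for all sufficiently small integers $n$. It is simple if it is nonzero and $0$ and $M$ are its only submodules, and completely reducible if it is a direct sum of simple $V$-modules. An admissible $V$-module is a weak $V$-module $M$ with a grading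 $M=\bigoplus_{n\in\mathbb Z_{\ge0}}M(n)$ such that $a_mM(n)\subseteq M(n+k-m-1)$ for all $a\in V_k$, $k,m\in\mathbb Z$ (with $M(j)=0$ for $j<0$). It is simple if it is nonzero and $0$ and $M$ are its only graded submodules. $V$ is rational if every admissible $V$-module is a direct sum of simple admissible (graded) submodules. $V$ is holomorphic if $V$ is, up to isomorphism, the only simple $V$-module. Proposition. Suppose that $V$ is a holomorphic vertex operator algebra, and that $V$ contains a vertex operator subalgebra $U$ (a subspace containing $\mathbf 1$ and $\omega$ and closed under all products $a_nb$) with the same Virasoro element $\omega$ which, as a vertex operator algebra, is rational. Then every $V$-module is completely reducible. -/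

import Mathlib

universe u v

/-- The coefficients of the Jacobi identity
`z₀⁻¹ δ((z₁ - z₂)/z₀) Y_M(a, z₁) Y_M(b, z₂) - z₀⁻¹ δ((z₂ - z₁)/(-z₀)) Y_M(b, z₂) Y_M(a, z₁)
  = z₂⁻¹ δ((z₁ - z₀)/z₂) Y_M(Y(a, z₀) b, z₂)`
at `z₀ ^ (-l-1) z₁ ^ (-m-1) z₂ ^ (-n-1)`, where `Y(a, z) = ∑ a_n z ^ (-n-1)`, `a_n = y n a`, and
`Y_M(a, z) = ∑ a_n z ^ (-n-1)`, `a_n = yM n a`. Under the truncation axioms (assumed wherever this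
is used) each of the three sums over `i` has finite support. -/
def JacobiIdentity {V : Type u} [AddCommGroup V] [Module ℂ V] {M : Type v} [AddCommGroup M]
    [Module ℂ M] (y : ℤ → V →ₗ[ℂ] Module.End ℂ V) (yM : ℤ → V →ₗ[ℂ] Module.End ℂ M) : Prop :=
  ∀ (a b : V) (w : M) (l m n : ℤ),
    (∑ᶠ i : ℕ, ((-1 : ℂ) ^ i * (Ring.choose l i : ℂ)) • yM (m + l - i) a (yM (n + i) b w))
      - (∑ᶠ i : ℕ, ((-1 : ℂ) ^ l * (-1 : ℂ) ^ i * (Ring.choose l i : ℂ)) •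
          yM (n + l - i) b (yM (m + i) a w))
      = ∑ᶠ i : ℕ, (Ring.choose m i : ℂ) • yM (m + n - i) (y (l + i) a b) w

/-- A vertex operator algebra structure `(V, Y, 𝟏, ω)` on a complex vector space `V`. The vertex
operators are `Y(a, z) = ∑ a_n z ^ (-n-1)` with `a_n = mode n a`, and `L(n) = ω_{n+1}`.
The ℤ-grading of `V` is the decomposition into the eigenspaces `V_n` of `L(0)`; eigenspaces are
automatically independent, so that `V = ⨁ V_n` says that they span. -/
structure VertexOperatorAlgebra (V : Type u) [AddCommGroup V] [Module ℂ V] where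
  /-- `mode n a` is the endomorphism `a_n`. -/
  mode : ℤ → V →ₗ[ℂ] Module.End ℂ V
  /-- The vacuum vector `𝟏`. -/
  vac : V
  /-- The Virasoro element `ω`. -/
  omega : V
  /-- The rank (central charge). -/
  rank : ℂ
  truncation : ∀ a b : V, ∃ N : ℤ, ∀ n : ℤ, N ≤ n → mode n a b = 0
  vacuum : ∀ (n : ℤ) (b : V), mode n vac b = if n = -1 then b else 0
  creation : ∀ a : V, mode (-1) a vac = a
  creation_nonneg : ∀ (a : V) (n : ℤ), 0 ≤ n → mode n a vac = 0
  jacobi : JacobiIdentity mode mode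
  virasoro : ∀ (m n : ℤ) (b : V),
    mode (m + 1) omega (mode (n + 1) omega b) - mode (n + 1) omega (mode (m + 1) omega b)
      = ((m : ℂ) - n) • mode (m + n + 1) omega b
        + (if m + n = 0 then ((m : ℂ) ^ 3 - m) / 12 * rank else 0) • b
  derivative : ∀ (a b : V) (n : ℤ),
    mode n (mode 0 omega a) b = (-(n : ℂ)) • mode (n - 1) a b
  grading : ⨆ n : ℤ, Module.End.eigenspace (mode 1 omega) (n : ℂ) = ⊤
  finite_weight : ∀ n : ℤ,
    FiniteDimensional ℂ (Module.End.eigenspace (mode 1 omega) (n : ℂ))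
  lower_bound : ∃ N : ℤ, ∀ n : ℤ, n < N →
    Module.End.eigenspace (mode 1 omega) (n : ℂ) = ⊥

namespace VertexOperatorAlgebra

section

variable {V : Type u} [AddCommGroup V] [Module ℂ V]

/-- The weight space `V_n = {a | L(0) a = n a}`. -/
def weightSpace (A : VertexOperatorAlgebra V) (n : ℤ) : Submodule ℂ V :=
  Module.End.eigenspace (A.mode 1 A.omega) (n : ℂ)

/-- A weak module structure on `M` over the vertex operator algebra `A`, with
`Y_M(a, z) = ∑ a_n z ^ (-n-1)`, `a_n = mode n a`. -/
structure WeakModule (A : VertexOperatorAlgebra V) (M : Type v) [AddCommGroup M]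
    [Module ℂ M] where
  /-- `mode n a` is the endomorphism `a_n` of `M`. -/
  mode : ℤ → V →ₗ[ℂ] Module.End ℂ M
  truncation : ∀ (a : V) (w : M), ∃ N : ℤ, ∀ n : ℤ, N ≤ n → mode n a w = 0
  vacuum : ∀ (n : ℤ) (w : M), mode n A.vac w = if n = -1 then w else 0
  jacobi : JacobiIdentity A.mode mode

namespace WeakModule

variable {A : VertexOperatorAlgebra V} {M : Type v} [AddCommGroup M] [Module ℂ M]

/-- The eigenspace `M_z = {w | L(0) w = z w}`. -/
def weightSpace (W : A.WeakModule M) (z : ℂ) : Submodule ℂ M :=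
  Module.End.eigenspace (W.mode 1 A.omega) z

/-- `W` is an (ordinary) `V`-module: `M` is the direct sum of the eigenspaces `M_z` of `L(0)`
(eigenspaces are automatically independent), every `M_z` is finite-dimensional, and for fixed `z`,
`M_{z+n} = 0` for all small enough integers `n`. -/
structure IsOrdinary (W : A.WeakModule M) : Prop where
  grading : ⨆ z : ℂ, W.weightSpace z = ⊤
  finite_weight : ∀ z : ℂ, FiniteDimensional ℂ (W.weightSpace z)
  lower_bound : ∀ z : ℂ, ∃ N : ℤ, ∀ n : ℤ, n < N → W.weightSpace (z + n) = ⊥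

/-- The subspace `K` is a submodule: it is stable under all `a_n`. -/
def IsSubmodule (W : A.WeakModule M) (K : Submodule ℂ M) : Prop :=
  ∀ (a : V) (n : ℤ), ∀ w ∈ K, W.mode n a w ∈ K

/-- The subspace `K` is a simple submodule. -/
def IsSimpleSubmodule (W : A.WeakModule M) (K : Submodule ℂ M) : Prop :=
  W.IsSubmodule K ∧ K ≠ ⊥ ∧ ∀ K' ≤ K, W.IsSubmodule K' → K' = ⊥ ∨ K' = K

/-- `W` is simple: it is nonzero, and `0` and `M` are its only submodules. -/
def IsSimple (W : A.WeakModule M) : Prop := W.IsSimpleSubmodule ⊤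

/-- `W` is completely reducible: it is the (internal) direct sum of a set of simple
submodules. -/
def IsCompletelyReducible (W : A.WeakModule M) : Prop :=
  ∃ S : Set (Submodule ℂ M), (∀ K ∈ S, W.IsSimpleSubmodule K) ∧ sSupIndep S ∧ sSup S = ⊤

/-- Equivalence of modules: a linear isomorphism commuting with the vertex operators. -/
def Equivalent {M' : Type*} [AddCommGroup M'] [Module ℂ M'] (W : A.WeakModule M)
    (W' : A.WeakModule M') : Prop :=
  ∃ f : M ≃ₗ[ℂ] M', ∀ (a : V) (n : ℤ) (w : M), f (W.mode n a w) = W'.mode n a (f w)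

/-- The family `G` makes `W` an admissible module: `M = ⨁_{n ≥ 0} G n`, and
`a_m G(n) ⊆ G(n + wt a - m - 1)` for homogeneous `a`. The index runs through `ℤ`, with
`G n = 0` for `n < 0`. -/
structure IsAdmissible (W : A.WeakModule M) (G : ℤ → Submodule ℂ M) : Prop where
  internal : DirectSum.IsInternal G
  nonneg : ∀ n : ℤ, n < 0 → G n = ⊥
  mode_mem : ∀ (k : ℤ), ∀ a ∈ A.weightSpace k, ∀ (m n : ℤ), ∀ w ∈ G n,
    W.mode m a w ∈ G (n + k - m - 1)

/-- `K` is a graded submodule: a submodule with `K = ⨁ (K ∩ G n)`. -/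
def IsGradedSubmodule (W : A.WeakModule M) (G : ℤ → Submodule ℂ M) (K : Submodule ℂ M) : Prop :=
  W.IsSubmodule K ∧ ⨆ n : ℤ, K ⊓ G n = K

/-- `K` is simple as an admissible module, that is, with respect to graded submodules. -/
def IsSimpleGradedSubmodule (W : A.WeakModule M) (G : ℤ → Submodule ℂ M)
    (K : Submodule ℂ M) : Prop :=
  W.IsGradedSubmodule G K ∧ K ≠ ⊥ ∧ ∀ K' ≤ K, W.IsGradedSubmodule G K' → K' = ⊥ ∨ K' = K

/-- The admissible module `(W, G)` is completely reducible: it is the (internal) direct sum of a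
set of graded submodules that are simple admissible modules. -/
def IsCompletelyReducibleGraded (W : A.WeakModule M) (G : ℤ → Submodule ℂ M) : Prop :=
  ∃ S : Set (Submodule ℂ M),
    (∀ K ∈ S, W.IsSimpleGradedSubmodule G K) ∧ sSupIndep S ∧ sSup S = ⊤

end WeakModule

/-- `V` as a module over itself. -/
def regular (A : VertexOperatorAlgebra V) : A.WeakModule V where
  mode := A.mode
  truncation := A.truncation
  vacuum := A.vacuum
  jacobi := A.jacobi

/-- `V` is rational: every admissible `V`-module is completely reducible. -/
def IsRational (A : VertexOperatorAlgebra V) : Prop :=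
  ∀ (M : Type u) [AddCommGroup M] [Module ℂ M] (W : A.WeakModule M) (G : ℤ → Submodule ℂ M),
    W.IsAdmissible G → W.IsCompletelyReducibleGraded G

/-- `V` is holomorphic: `V` is the only simple (ordinary) `V`-module up to equivalence. -/
def IsHolomorphic (A : VertexOperatorAlgebra V) : Prop :=
  (A.regular.IsOrdinary ∧ A.regular.IsSimple) ∧
    ∀ (M : Type u) [AddCommGroup M] [Module ℂ M] (W : A.WeakModule M),
      W.IsOrdinary → W.IsSimple → W.Equivalent A.regular

/-- The subspace `U` is a vertex operator subalgebra of `V` with the same Virasoro element. -/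
structure IsSubalgebra (A : VertexOperatorAlgebra V) (U : Submodule ℂ V) : Prop where
  vac_mem : A.vac ∈ U
  omega_mem : A.omega ∈ U
  mode_mem : ∀ (n : ℤ), ∀ a ∈ U, ∀ b ∈ U, A.mode n a b ∈ U

/-- The restriction of the vertex operators to a subalgebra. -/
def subMode (A : VertexOperatorAlgebra V) (U : Submodule ℂ V) (hU : A.IsSubalgebra U) (n : ℤ) :
    U →ₗ[ℂ] Module.End ℂ U where
  toFun a := (A.mode n (a : V)).restrict (hU.mode_mem n a a.2)
  map_add' a b := by ext c; simp [LinearMap.restrict_apply]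
  map_smul' r a := by ext c; simp [LinearMap.restrict_apply]

theorem coe_subMode (A : VertexOperatorAlgebra V) (U : Submodule ℂ V) (hU : A.IsSubalgebra U)
    (n : ℤ) (a b : U) : (A.subMode U hU n a b : V) = A.mode n (a : V) (b : V) := rfl

theorem eigenspace_subMode (A : VertexOperatorAlgebra V) (U : Submodule ℂ V)
    (hU : A.IsSubalgebra U) (z : ℂ) :
    Module.End.eigenspace (A.subMode U hU 1 ⟨A.omega, hU.omega_mem⟩) z
      = (Module.End.eigenspace (A.mode 1 A.omega) z).comap U.subtype := by
  ext x
  simp only [Module.End.mem_eigenspace_iff, Submodule.mem_comap, Submodule.subtype_apply]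
  rw [Subtype.ext_iff, coe_subMode]
  simp

/-- If a sum of eigenvectors for distinct eigenvalues lies in a stable subspace, so do its terms. -/
theorem mem_of_sum_mem (f : Module.End ℂ V) (U : Submodule ℂ V) (hU : ∀ x ∈ U, f x ∈ U)
    (s : Finset ℤ) : ∀ x : ℤ → V, (∀ n ∈ s, x n ∈ f.eigenspace (n : ℂ)) →
      ∑ n ∈ s, x n ∈ U → ∀ n ∈ s, x n ∈ U := by
  induction s using Finset.induction_on with
  | empty => simp
  | insert k s hk ih =>
    intro x hx hsum
    have h1 : ∑ n ∈ s, ((n : ℂ) - k) • x n ∈ U := by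
      have h2 := U.sub_mem (hU _ hsum) (U.smul_mem (k : ℂ) hsum)
      convert h2 using 1
      rw [map_sum, Finset.smul_sum, ← Finset.sum_sub_distrib, Finset.sum_insert hk,
        Module.End.mem_eigenspace_iff.mp (hx k (Finset.mem_insert_self k s)), sub_self, zero_add]
      refine Finset.sum_congr rfl fun n hn => ?_
      rw [Module.End.mem_eigenspace_iff.mp (hx n (Finset.mem_insert_of_mem hn)), sub_smul]
    have h3 : ∀ n ∈ s, x n ∈ U := by
      intro n hn
      have h4 := ih (fun n => ((n : ℂ) - k) • x n)
        (fun n hn => Submodule.smul_mem _ _ (hx n (Finset.mem_insert_of_mem hn))) h1 n hn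
      have hne : (n : ℂ) - k ≠ 0 := by
        rw [sub_ne_zero, Int.cast_injective.ne_iff]
        rintro rfl
        exact hk hn
      exact (Submodule.smul_mem_iff U hne).mp h4
    intro n hn
    rcases Finset.mem_insert.mp hn with rfl | hn
    · rw [Finset.sum_insert hk] at hsum
      exact (Submodule.add_mem_iff_left U (U.sum_mem h3)).mp hsum
    · exact h3 n hn

theorem iSup_eigenspace_subMode (A : VertexOperatorAlgebra V) (U : Submodule ℂ V)
    (hU : A.IsSubalgebra U) :
    ⨆ n : ℤ, Module.End.eigenspace (A.subMode U hU 1 ⟨A.omega, hU.omega_mem⟩) (n : ℂ) = ⊤ := by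
  rw [eq_top_iff]
  rintro ⟨x, hxU⟩ -
  have hx : x ∈ ⨆ n : ℤ, Module.End.eigenspace (A.mode 1 A.omega) (n : ℂ) := by
    rw [A.grading]; trivial
  obtain ⟨g, hg, rfl⟩ := (Submodule.mem_iSup_iff_exists_finsupp _ _).mp hx
  have hmem : ∀ n ∈ g.support, g n ∈ U :=
    mem_of_sum_mem (A.mode 1 A.omega) U (fun y hy => hU.mode_mem 1 _ hU.omega_mem y hy)
      g.support g (fun n _ => hg n) hxU
  have hsum : (⟨g.sum fun _ y => y, hxU⟩ : U)
      = ∑ n ∈ g.support.attach, ⟨g n, hmem n n.2⟩ := by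
    apply Subtype.ext
    rw [Submodule.coe_sum]
    exact (Finset.sum_attach g.support g).symm
  rw [hsum]
  refine Submodule.sum_mem _ fun n _ => ?_
  refine Submodule.mem_iSup_of_mem (n : ℤ) ?_
  rw [eigenspace_subMode]
  exact hg n

/-- A vertex operator subalgebra, as a vertex operator algebra in its own right, with the same
vacuum and the same Virasoro element. -/
def subalgebra (A : VertexOperatorAlgebra V) (U : Submodule ℂ V) (hU : A.IsSubalgebra U) :
    VertexOperatorAlgebra U where
  mode := A.subMode U hU
  vac := ⟨A.vac, hU.vac_mem⟩
  omega := ⟨A.omega, hU.omega_mem⟩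
  rank := A.rank
  truncation a b := by
    obtain ⟨N, hN⟩ := A.truncation a b
    exact ⟨N, fun n hn => Subtype.ext (hN n hn)⟩
  vacuum n b := by
    apply Subtype.ext
    rw [coe_subMode, A.vacuum]
    split_ifs <;> rfl
  creation a := Subtype.ext (A.creation a)
  creation_nonneg a n hn := Subtype.ext (A.creation_nonneg a n hn)
  jacobi a b w l m n := by
    have key : ∀ f : ℕ → U, ((∑ᶠ i, f i : U) : V) = ∑ᶠ i, (f i : V) := fun f =>
      U.subtype.toAddMonoidHom.map_finsum_of_injective Subtype.val_injective f
    apply Subtype.ext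
    rw [Submodule.coe_sub, key, key, key]
    exact A.jacobi a b w l m n
  virasoro m n b :=
     Subtype.ext (A.virasoro m n b)
  derivative a b n := Subtype.ext (A.derivative a b n)
  grading := A.iSup_eigenspace_subMode U hU
  finite_weight n := by
    rw [eigenspace_subMode]
    have := A.finite_weight n
    exact FiniteDimensional.of_injective
      (U.subtype.restrict (p := (Module.End.eigenspace (A.mode 1 A.omega) (n : ℂ)).comap U.subtype)
        (q := Module.End.eigenspace (A.mode 1 A.omega) (n : ℂ)) (fun _ hx => hx))
      (fun x y h => by
        have h' := Subtype.ext_iff.mp h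
        exact Subtype.ext (Subtype.ext h'))
  lower_bound := by
    obtain ⟨N, hN⟩ := A.lower_bound
    refine ⟨N, fun n hn => ?_⟩
    rw [eigenspace_subMode, hN n hn]
    simp

end

end VertexOperatorAlgebra

/-!
As a module over `U`, an ordinary `V`-module `W` is completely reducible: the weights in one coset
of `ℤ` in `ℂ` give an admissible module. Reduce to cyclic `W`, and suppose that the sum of its
simple submodules is proper, hence contained in a maximal submodule `K`. Then `W / K` is a simple
module, so it is `V` by holomorphy. Lift the vacuum to a vector `w` in a `U`-stable complement of
`K`. Since `L(-1) = ω₀` is a mode of `U`, the vector `L(-1) w` lies both in the complement and in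
`K`, so `L(-1) w = 0`. This forces `a_n w = 0` for `n ≥ 0`, so that `a ↦ a_{-1} w` is a homomorphism
from `V`; its image is a simple submodule not contained in `K`, a contradiction.
-/

namespace VertexOperatorAlgebra

section Eigenspaces

open Module.End

variable {𝕜 E F ι : Type*} [Field 𝕜] [AddCommGroup E] [Module 𝕜 E] [AddCommGroup F] [Module 𝕜 F]
  {f : Module.End 𝕜 E} {f' : Module.End 𝕜 F} {g : E →ₗ[𝕜] F}

theorem map_eigenspace_le (hgf : ∀ x, g (f x) = f' (g x)) (μ : 𝕜) :
    (f.eigenspace μ).map g ≤ f'.eigenspace μ := by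
  rintro _ ⟨x, hx, rfl⟩
  rw [mem_eigenspace_iff, ← hgf, mem_eigenspace_iff.mp hx, map_smul]

theorem map_eigenspace_of_injective (hg : Function.Injective g)
    (hgf : ∀ x, g (f x) = f' (g x)) (μ : 𝕜) :
    (f.eigenspace μ).map g = LinearMap.range g ⊓ f'.eigenspace μ := by
  refine le_antisymm (le_inf LinearMap.map_le_range (map_eigenspace_le hgf μ)) ?_
  rintro _ ⟨⟨x, rfl⟩, hx⟩
  refine ⟨x, mem_eigenspace_iff.mpr (hg ?_), rfl⟩
  rw [hgf, mem_eigenspace_iff.mp hx, map_smul]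

theorem map_eigenspace_of_surjective (hg : Function.Surjective g)
    (hgf : ∀ x, g (f x) = f' (g x)) (hf : ⨆ μ, f.eigenspace μ = ⊤) (μ : 𝕜) :
    (f.eigenspace μ).map g = f'.eigenspace μ := by
  have htop : ⨆ ν, (f.eigenspace ν).map g = ⊤ := by
    rw [← Submodule.map_iSup, hf, Submodule.map_top, LinearMap.range_eq_top.mpr hg]
  exact congrFun ((f'.eigenspaces_iSupIndep.le_iff_eq_of_iSup_eq_top htop).mp
    (map_eigenspace_le hgf)) μ

theorem iSup_inf_eigenspace {e : ι → 𝕜} (he : Function.Injective e)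
    (hf : ⨆ i, f.eigenspace (e i) = ⊤) {K : Submodule 𝕜 E} (hK : ∀ x ∈ K, f x ∈ K) :
    ⨆ i, K ⊓ f.eigenspace (e i) = K := by
  refine le_antisymm (iSup_le fun i => inf_le_left) fun x hx => ?_
  classical
  obtain ⟨c, hc, rfl⟩ := (Submodule.mem_iSup_iff_exists_finsupp _ _).mp
    (hf ▸ Submodule.mem_top (x := x))
  refine Submodule.sum_mem _ fun i hi => Submodule.mem_iSup_of_mem i ⟨?_, hc i⟩
  -- In `E ⧸ K` the classes of the components are eigenvectors with sum zero, hence all zero.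
  have hmem (i : ι) : K.mkQ (c i) ∈ eigenspace (K.mapQ K f hK) (e i) :=
    map_eigenspace_le (g := K.mkQ) (fun _ => rfl) (e i) (Submodule.mem_map_of_mem (hc i))
  have hsum : ∑ i ∈ c.support, K.mkQ (c i) = 0 := by
    rw [← map_sum]
    exact (Submodule.Quotient.mk_eq_zero K).mpr hx
  have hindep := (eigenspaces_iSupIndep (K.mapQ K f hK)).comp he
  exact (Submodule.Quotient.mk_eq_zero K).mp <|
    (iSupIndep_iff_finsetSum_eq_zero_imp_eq_zero _).mp hindep c.support (fun i => K.mkQ (c i))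
      (fun i _ => hmem i) hsum i hi

theorem iSup_eigenspace_eq_top_of_injective (hg : Function.Injective g)
    (hgf : ∀ x, g (f x) = f' (g x)) (hf' : ⨆ μ, f'.eigenspace μ = ⊤) :
    ⨆ μ, f.eigenspace μ = ⊤ := by
  apply Submodule.map_injective_of_injective hg
  simp_rw [Submodule.map_iSup, map_eigenspace_of_injective hg hgf, Submodule.map_top]
  refine iSup_inf_eigenspace (e := id) Function.injective_id hf' ?_
  rintro _ ⟨x, rfl⟩
  exact ⟨f x, hgf x⟩

end Eigenspaces

section Coefficients

theorem neg_one_pow_mul_choose_neg_two (i : ℕ) :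
    (-1 : ℂ) ^ i * Ring.choose (-2 : ℂ) i = i + 1 := by
  rw [Ring.choose_neg, show (2 : ℂ) + i - 1 = ((i + 1 : ℕ) : ℂ) by push_cast; ring,
    Ring.choose_natCast, Nat.choose_succ_self_right, Int.negOnePow_def, Units.smul_def]
  simp [← mul_assoc, ← mul_pow, mul_add]

theorem hasFiniteSupport_of_eventually_eq_zero {E : Type*} [AddCommGroup E] {f : ℕ → E} (N : ℤ)
    (hf : ∀ i : ℕ, N ≤ i → f i = 0) : Function.HasFiniteSupport f :=
  (Set.finite_lt_nat N.toNat).subset fun i hi =>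
    show i < N.toNat from lt_of_not_ge fun hle => hi (hf i (Int.toNat_le.mp hle))

variable {E : Type*} [AddCommGroup E] [Module ℂ E]

theorem finsum_choose_zero_smul (f : ℕ → E) :
    ∑ᶠ i : ℕ, (Ring.choose (0 : ℂ) i) • f i = f 0 := by
  rw [finsum_eq_single _ 0 fun i hi => by
    rw [Ring.choose_zero_pos ℂ (Nat.pos_of_ne_zero hi), zero_smul],
    Ring.choose_zero_right, one_smul]

theorem finsum_choose_one_smul (f : ℕ → E) :
    ∑ᶠ i : ℕ, (Ring.choose (1 : ℂ) i) • f i = f 0 + f 1 := by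
  have hchoose (i : ℕ) : Ring.choose (1 : ℂ) i = Nat.choose 1 i := by
    exact_mod_cast Ring.choose_natCast (R := ℂ) 1 i
  rw [finsum_eq_sum_of_support_subset (s := Finset.range 2)]
  · simp [Finset.sum_range_succ, hchoose]
  · intro i hi
    by_contra hlt
    have : 1 < i := by simpa [Nat.lt_iff_add_one_le] using hlt
    exact hi (by simp [hchoose, Nat.choose_eq_zero_of_lt this])

theorem finsum_succ_smul_ite (f : ℤ → E) (m : ℤ) :
    ∑ᶠ i : ℕ, ((i : ℂ) + 1) • (if (i : ℤ) = m then f i else 0) =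
      if 0 ≤ m then ((m : ℂ) + 1) • f m else 0 := by
  split_ifs with hm
  · lift m to ℕ using hm
    rw [finsum_eq_single _ m fun i hi => by rw [if_neg (by exact_mod_cast hi), smul_zero],
      if_pos rfl, Int.cast_natCast]
  · refine finsum_eq_zero_of_forall_eq_zero fun i => ?_
    rw [if_neg (by omega), smul_zero]

end Coefficients

theorem vac_ne_zero_of_isSimple {V : Type u} [AddCommGroup V] [Module ℂ V]
    {A : VertexOperatorAlgebra V} (hA : A.regular.IsSimple) : A.vac ≠ 0 := fun hvac =>
  hA.2.1 <| (Submodule.eq_bot_iff _).mpr fun b _ => by simpa [hvac] using (A.vacuum (-1) b).symm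

namespace WeakModule

variable {V : Type u} [AddCommGroup V] [Module ℂ V] {A : VertexOperatorAlgebra V}

section Jacobi

variable {M : Type v} [AddCommGroup M] [Module ℂ M]

theorem mode_mode (W : A.WeakModule M) (a b : V) (w : M) (l n : ℤ) :
    W.mode n (A.mode l a b) w =
      (∑ᶠ i : ℕ, ((-1 : ℂ) ^ i * (Ring.choose l i : ℂ)) • W.mode (l - i) a (W.mode (n + i) b w))
      - (∑ᶠ i : ℕ, ((-1 : ℂ) ^ l * (-1 : ℂ) ^ i * (Ring.choose l i : ℂ)) •
          W.mode (n + l - i) b (W.mode i a w)) := by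
  have h := W.jacobi a b w l 0 n
  simp only [Int.cast_zero] at h
  rw [finsum_choose_zero_smul] at h
  simpa using h.symm

theorem commutator (W : A.WeakModule M) (a b : V) (w : M) (m n : ℤ) :
    W.mode m a (W.mode n b w) - W.mode n b (W.mode m a w) =
      ∑ᶠ i : ℕ, (Ring.choose m i : ℂ) • W.mode (m + n - i) (A.mode i a b) w := by
  have h := W.jacobi a b w 0 m n
  simp only [Int.cast_zero, zpow_zero, one_mul, mul_comm _ (Ring.choose (0 : ℂ) _), mul_smul] at h
  rw [finsum_choose_zero_smul, finsum_choose_zero_smul] at h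
  simpa using h

theorem mode_mode_zero_omega (W : A.WeakModule M) (a : V) (n : ℤ) (w : M) :
    W.mode n (A.mode 0 A.omega a) w = (-(n : ℂ)) • W.mode (n - 1) a w := by
  have hvac : A.mode 0 A.omega a = A.mode (-2) a A.vac := by
    rw [← A.creation (A.mode 0 A.omega a), A.derivative]
    simp
  have hleft (i : ℕ) : W.mode (-2 - i) a (if n + i = -1 then w else 0) =
      if (i : ℤ) = -1 - n then W.mode (-2 - i) a w else 0 := by
    rw [apply_ite (W.mode (-2 - i) a), map_zero]
    exact if_congr (by omega) rfl rfl
  have hright (i : ℕ) : (if n + -2 - i = -1 then W.mode i a w else 0) =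
      if (i : ℤ) = n - 1 then W.mode i a w else 0 :=
    if_congr (by omega) rfl rfl
  have hsign : (-1 : ℂ) ^ (-2 : ℤ) = 1 := by norm_num
  rw [hvac, mode_mode]
  simp only [W.vacuum, Int.cast_neg, Int.cast_ofNat, hsign, one_mul,
    neg_one_pow_mul_choose_neg_two, hleft, hright]
  rw [finsum_succ_smul_ite fun i => W.mode (-2 - i) a w,
    finsum_succ_smul_ite fun i => W.mode i a w, show -2 - (-1 - n) = n - 1 by ring]
  rcases lt_trichotomy n 0 with hn | rfl | hn
  · rw [if_pos (by omega), if_neg (by omega)]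
    push_cast
    module
  · simp
  · rw [if_neg (by omega), if_pos (by omega)]
    push_cast
    module

theorem commutator_omega_zero (W : A.WeakModule M) (b : V) (n : ℤ) (w : M) :
    W.mode 0 A.omega (W.mode n b w) - W.mode n b (W.mode 0 A.omega w) =
      (-(n : ℂ)) • W.mode (n - 1) b w := by
  rw [commutator, Int.cast_zero, finsum_choose_zero_smul]
  simpa using W.mode_mode_zero_omega b n w

theorem commutator_omega_one (W : A.WeakModule M) {k : ℤ} {b : V} (hb : b ∈ A.weightSpace k)
    (n : ℤ) (w : M) :
    W.mode 1 A.omega (W.mode n b w) - W.mode n b (W.mode 1 A.omega w) =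
      ((k : ℂ) - n - 1) • W.mode n b w := by
  have hb' : A.mode 1 A.omega b = (k : ℂ) • b := Module.End.mem_eigenspace_iff.mp hb
  rw [commutator, Int.cast_one, finsum_choose_one_smul]
  simp only [Nat.cast_zero, Nat.cast_one, sub_zero, mode_mode_zero_omega, hb', map_smul,
    LinearMap.smul_apply, add_sub_cancel_left, Int.cast_add, Int.cast_one]
  module

theorem mode_mem_weightSpace (W : A.WeakModule M) {k : ℤ} {b : V} (hb : b ∈ A.weightSpace k)
    (n : ℤ) {z : ℂ} {w : M} (hw : w ∈ W.weightSpace z) :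
    W.mode n b w ∈ W.weightSpace (z + k - n - 1) := by
  refine Module.End.mem_eigenspace_iff.mpr ?_
  have h := W.commutator_omega_one hb n w
  rw [Module.End.mem_eigenspace_iff.mp hw, map_smul, sub_eq_iff_eq_add] at h
  rw [h]
  module

end Jacobi

section Homomorphisms

variable {M M' : Type*} [AddCommGroup M] [Module ℂ M] [AddCommGroup M'] [Module ℂ M']
  {W : A.WeakModule M} {W' : A.WeakModule M'} {f : M →ₗ[ℂ] M'}

/-- The linear map `f` is a homomorphism of weak modules: it commutes with all modes. -/
def IsHom (W : A.WeakModule M) (W' : A.WeakModule M') (f : M →ₗ[ℂ] M') : Prop :=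
  ∀ (a : V) (n : ℤ) (w : M), f (W.mode n a w) = W'.mode n a (f w)

theorem IsSubmodule.inf {K L : Submodule ℂ M} (hK : W.IsSubmodule K) (hL : W.IsSubmodule L) :
    W.IsSubmodule (K ⊓ L) :=
  fun a n _ hw => ⟨hK a n _ hw.1, hL a n _ hw.2⟩

theorem IsHom.isSubmodule_map (hf : W.IsHom W' f) {K : Submodule ℂ M} (hK : W.IsSubmodule K) :
    W'.IsSubmodule (K.map f) := by
  rintro a n _ ⟨w, hw, rfl⟩
  exact ⟨W.mode n a w, hK a n w hw, hf a n w⟩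

theorem IsHom.isSubmodule_comap (hf : W.IsHom W' f) {K : Submodule ℂ M'}
    (hK : W'.IsSubmodule K) : W.IsSubmodule (K.comap f) := fun a n w hw => by
  rw [Submodule.mem_comap, hf]
  exact hK a n (f w) hw

theorem IsHom.isSubmodule_ker (hf : W.IsHom W' f) : W.IsSubmodule (LinearMap.ker f) :=
  fun a n w hw => by rw [LinearMap.mem_ker, hf, LinearMap.mem_ker.mp hw, map_zero]

theorem IsHom.isSimpleSubmodule_map (hf : W.IsHom W' f) {K : Submodule ℂ M}
    (hK : W.IsSimpleSubmodule K) (hne : K.map f ≠ ⊥) : W'.IsSimpleSubmodule (K.map f) := by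
  refine ⟨hf.isSubmodule_map hK.1, hne, fun L hL hLsub => ?_⟩
  have hmap : (K ⊓ L.comap f).map f = L := by
    rw [← Submodule.map_inf_eq_map_inf_comap, inf_eq_right.mpr hL]
  rcases hK.2.2 _ inf_le_left (hK.1.inf (hf.isSubmodule_comap hLsub)) with h | h
  · exact Or.inl (by rw [← hmap, h, Submodule.map_bot])
  · exact Or.inr (by rw [← hmap, h])

theorem IsHom.map_weightSpace_le (hf : W.IsHom W' f) (z : ℂ) :
    (W.weightSpace z).map f ≤ W'.weightSpace z :=
  map_eigenspace_le (hf A.omega 1) z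

theorem IsHom.isOrdinary_of_injective (hf : W.IsHom W' f) (hinj : Function.Injective f)
    (hW' : W'.IsOrdinary) : W.IsOrdinary where
  grading := iSup_eigenspace_eq_top_of_injective hinj (hf A.omega 1) hW'.grading
  finite_weight z := by
    have := hW'.finite_weight z
    have := Submodule.finiteDimensional_of_le (hf.map_weightSpace_le z)
    exact (Submodule.equivMapOfInjective f hinj (W.weightSpace z)).symm.finiteDimensional
  lower_bound z := by
    obtain ⟨N, hN⟩ := hW'.lower_bound z
    refine ⟨N, fun n hn => Submodule.map_injective_of_injective hinj ?_⟩
    rw [Submodule.map_bot]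
    exact eq_bot_iff.mpr (hN n hn ▸ hf.map_weightSpace_le (z + n))

theorem IsHom.isOrdinary_of_surjective (hf : W.IsHom W' f) (hsurj : Function.Surjective f)
    (hW : W.IsOrdinary) : W'.IsOrdinary := by
  have hmap (z : ℂ) : (W.weightSpace z).map f = W'.weightSpace z :=
    map_eigenspace_of_surjective hsurj (hf A.omega 1) hW.grading z
  refine ⟨?_, fun z => ?_, fun z => ?_⟩
  · simp_rw [← hmap]
    rw [← Submodule.map_iSup, hW.grading, Submodule.map_top, LinearMap.range_eq_top.mpr hsurj]
  · have := hW.finite_weight z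
    rw [← hmap]
    infer_instance
  · obtain ⟨N, hN⟩ := hW.lower_bound z
    exact ⟨N, fun n hn => by rw [← hmap, hN n hn, Submodule.map_bot]⟩

end Homomorphisms

section Constructions

variable {M : Type v} [AddCommGroup M] [Module ℂ M]

/-- A submodule `K` of a weak module, as a weak module. -/
def restrict (W : A.WeakModule M) (K : Submodule ℂ M) (hK : W.IsSubmodule K) :
    A.WeakModule K where
  mode n :=
    { toFun := fun a => (W.mode n a).restrict (hK a n)
      map_add' := fun a b => by ext c; simp [LinearMap.restrict_apply]
      map_smul' := fun r a => by ext c; simp [LinearMap.restrict_apply] }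
  truncation a w := by
    obtain ⟨N, hN⟩ := W.truncation a w
    exact ⟨N, fun n hn => Subtype.ext (hN n hn)⟩
  vacuum n w := by
    apply Subtype.ext
    refine (W.vacuum n w).trans ?_
    split_ifs <;> rfl
  jacobi a b w l m n := by
    have hcoe (f : ℕ → K) : ((∑ᶠ i, f i : K) : M) = ∑ᶠ i, (f i : M) :=
      K.subtype.toAddMonoidHom.map_finsum_of_injective Subtype.val_injective f
    apply Subtype.ext
    rw [Submodule.coe_sub, hcoe, hcoe, hcoe]
    exact W.jacobi a b w l m n

theorem isHom_subtype (W : A.WeakModule M) (K : Submodule ℂ M) (hK : W.IsSubmodule K) :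
    (W.restrict K hK).IsHom W K.subtype := fun _ _ _ => rfl

/-- The quotient of a weak module by a submodule `K`, as a weak module. -/
def quotient (W : A.WeakModule M) (K : Submodule ℂ M) (hK : W.IsSubmodule K) :
    A.WeakModule (M ⧸ K) where
  mode n :=
    { toFun := fun a => K.mapQ K (W.mode n a) (hK a n)
      map_add' := fun a b => by ext c; simp
      map_smul' := fun r a => by ext c; simp }
  truncation a w := by
    obtain ⟨w, rfl⟩ := K.mkQ_surjective w
    obtain ⟨N, hN⟩ := W.truncation a w
    refine ⟨N, fun n hn => ?_⟩
    change K.mkQ (W.mode n a w) = 0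
    rw [hN n hn, map_zero]
  vacuum n w := by
    obtain ⟨w, rfl⟩ := K.mkQ_surjective w
    change K.mkQ (W.mode n A.vac w) = _
    rw [W.vacuum]
    split_ifs <;> simp
  jacobi a b w l m n := by
    obtain ⟨w, rfl⟩ := K.mkQ_surjective w
    obtain ⟨N₁, h₁⟩ := W.truncation b w
    obtain ⟨N₂, h₂⟩ := W.truncation a w
    obtain ⟨N₃, h₃⟩ := A.truncation a b
    have h := congrArg K.mkQ (W.jacobi a b w l m n)
    rw [map_sub,
      map_finsum _ (hasFiniteSupport_of_eventually_eq_zero (N₁ - n) fun i hi => by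
        rw [h₁ _ (by omega), map_zero, smul_zero]),
      map_finsum _ (hasFiniteSupport_of_eventually_eq_zero (N₂ - m) fun i hi => by
        rw [h₂ _ (by omega), map_zero, smul_zero]),
      map_finsum _ (hasFiniteSupport_of_eventually_eq_zero (N₃ - l) fun i hi => by
        rw [h₃ _ (by omega), map_zero, LinearMap.zero_apply, smul_zero])] at h
    exact h

theorem isHom_mkQ (W : A.WeakModule M) (K : Submodule ℂ M) (hK : W.IsSubmodule K) :
    W.IsHom (W.quotient K hK) K.mkQ := fun _ _ _ => rfl

/-- A weak module over `A`, as a weak module over the vertex operator subalgebra `U`. -/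
def restrictSubalgebra (W : A.WeakModule M) (U : Submodule ℂ V) (hU : A.IsSubalgebra U) :
    (A.subalgebra U hU).WeakModule M where
  mode n := (W.mode n).comp U.subtype
  truncation a w := W.truncation a w
  vacuum n w := W.vacuum n w
  jacobi a b w l m n := W.jacobi a b w l m n

theorem IsSubmodule.restrictSubalgebra {W : A.WeakModule M} {K : Submodule ℂ M}
    (hK : W.IsSubmodule K) (U : Submodule ℂ V) (hU : A.IsSubalgebra U) :
    (W.restrictSubalgebra U hU).IsSubmodule K :=
  fun a => hK a

variable {W : A.WeakModule M}

theorem IsOrdinary.restrict (hW : W.IsOrdinary) (K : Submodule ℂ M) (hK : W.IsSubmodule K) :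
    (W.restrict K hK).IsOrdinary :=
  (W.isHom_subtype K hK).isOrdinary_of_injective K.injective_subtype hW

theorem IsOrdinary.quotient (hW : W.IsOrdinary) (K : Submodule ℂ M) (hK : W.IsSubmodule K) :
    (W.quotient K hK).IsOrdinary :=
  (W.isHom_mkQ K hK).isOrdinary_of_surjective K.mkQ_surjective hW

theorem IsOrdinary.restrictSubalgebra (hW : W.IsOrdinary) (U : Submodule ℂ V)
    (hU : A.IsSubalgebra U) : (W.restrictSubalgebra U hU).IsOrdinary :=
  ⟨hW.grading, hW.finite_weight, hW.lower_bound⟩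

end Constructions

section Socle

variable {M : Type v} [AddCommGroup M] [Module ℂ M] {W : A.WeakModule M}

/-- The associative algebra of operators on `M` generated by all modes, through which the theory
of semisimple modules over a ring applies to weak modules. -/
def modeAlgebra (W : A.WeakModule M) : Subalgebra ℂ (Module.End ℂ M) :=
  Algebra.adjoin ℂ {f | ∃ (n : ℤ) (a : V), W.mode n a = f}

theorem isSubmodule_restrictScalars (L : Submodule W.modeAlgebra M) :
    W.IsSubmodule (L.restrictScalars ℂ) :=
  fun a n _ hw => L.smul_mem ⟨W.mode n a, Algebra.subset_adjoin ⟨n, a, rfl⟩⟩ hw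

theorem IsSubmodule.exists_restrictScalars_eq {K : Submodule ℂ M} (hK : W.IsSubmodule K) :
    ∃ L : Submodule W.modeAlgebra M, L.restrictScalars ℂ = K := by
  refine ⟨{ K with smul_mem' := ?_ }, rfl⟩
  rintro ⟨f, hf⟩ x hx
  change f x ∈ K
  induction hf using Algebra.adjoin_induction generalizing x with
  | mem _ hf => obtain ⟨n, a, rfl⟩ := hf; exact hK a n x hx
  | algebraMap r => exact K.smul_mem r hx
  | add _ _ _ _ hf hg => exact K.add_mem (hf hx) (hg hx)
  | mul _ _ _ _ hf hg => exact hf (hg hx)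

theorem isSimpleSubmodule_restrictScalars_iff (L : Submodule W.modeAlgebra M) :
    W.IsSimpleSubmodule (L.restrictScalars ℂ) ↔ IsSimpleModule W.modeAlgebra L := by
  rw [isSimpleModule_iff_isAtom]
  constructor
  · rintro ⟨-, hne, hmin⟩
    refine ⟨fun h => hne (by rw [h, Submodule.restrictScalars_bot]), fun L' hlt => ?_⟩
    rcases hmin (L'.restrictScalars ℂ) hlt.le (isSubmodule_restrictScalars L') with h | h
    · exact (Submodule.restrictScalars_eq_bot_iff ℂ _ M).mp h
    · exact absurd (Submodule.restrictScalars_injective _ _ _ h) hlt.ne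
  · intro hL
    refine ⟨isSubmodule_restrictScalars L,
      fun h => hL.1 ((Submodule.restrictScalars_eq_bot_iff ℂ _ M).mp h), fun K hle hK => ?_⟩
    obtain ⟨L', rfl⟩ := hK.exists_restrictScalars_eq
    rcases hL.le_iff.mp hle with rfl | rfl
    · exact Or.inl (Submodule.restrictScalars_bot ℂ _ M)
    · exact Or.inr rfl

/-- The socle of a weak module: the sum of its simple submodules. -/
def socle (W : A.WeakModule M) : Submodule ℂ M := sSup {K | W.IsSimpleSubmodule K}

theorem socle_eq_restrictScalars (W : A.WeakModule M) : W.socle =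
    (sSup {L : Submodule W.modeAlgebra M | IsSimpleModule W.modeAlgebra L}).restrictScalars ℂ := by
  refine le_antisymm (sSup_le fun K hK => ?_) ?_
  · obtain ⟨L, rfl⟩ := hK.1.exists_restrictScalars_eq
    have hL : IsSimpleModule W.modeAlgebra L := (isSimpleSubmodule_restrictScalars_iff L).mp hK
    exact fun x hx => le_sSup (a := L) hL hx
  · rw [Submodule.restrictScalars_sSup]
    refine sSup_le ?_
    rintro _ ⟨L, hL, rfl⟩
    exact le_sSup ((isSimpleSubmodule_restrictScalars_iff L).mpr hL)

theorem isSubmodule_socle (W : A.WeakModule M) : W.IsSubmodule W.socle :=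
  W.socle_eq_restrictScalars ▸ isSubmodule_restrictScalars _

theorem socle_eq_top_iff_isSemisimpleModule :
    W.socle = ⊤ ↔ IsSemisimpleModule W.modeAlgebra M := by
  rw [socle_eq_restrictScalars, Submodule.restrictScalars_eq_top_iff,
    sSup_simples_eq_top_iff_isSemisimpleModule]

theorem isCompletelyReducible_iff_socle_eq_top : W.IsCompletelyReducible ↔ W.socle = ⊤ := by
  refine ⟨fun ⟨S, hS, _, hsup⟩ => top_unique (hsup ▸ sSup_le_sSup hS), fun h => ?_⟩
  have := socle_eq_top_iff_isSemisimpleModule.mp h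
  obtain ⟨s, hind, hsup, hs⟩ :=
    IsSemisimpleModule.exists_sSupIndep_sSup_simples_eq_top W.modeAlgebra M
  let φ := Submodule.restrictScalarsLatticeHom ℂ W.modeAlgebra M
  have hφ : Function.Injective φ := Submodule.restrictScalars_injective _ _ _
  refine ⟨φ '' s, ?_, ?_, ?_⟩
  · rintro _ ⟨L, hL, rfl⟩
    exact (isSimpleSubmodule_restrictScalars_iff L).mpr (hs L hL)
  · rintro _ ⟨L, hL, rfl⟩
    rw [← Set.image_singleton, ← Set.image_sdiff hφ, ← map_sSup φ]
    rw [disjoint_iff, ← map_inf, disjoint_iff.mp (hind hL), map_bot]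
  · rw [← map_sSup φ, hsup, map_top]

theorem IsCompletelyReducible.exists_isCompl (hW : W.IsCompletelyReducible) {K : Submodule ℂ M}
    (hK : W.IsSubmodule K) : ∃ C, W.IsSubmodule C ∧ IsCompl K C := by
  have := socle_eq_top_iff_isSemisimpleModule.mp (isCompletelyReducible_iff_socle_eq_top.mp hW)
  obtain ⟨L, rfl⟩ := hK.exists_restrictScalars_eq
  obtain ⟨C, hC⟩ := ComplementedLattice.exists_isCompl L
  exact ⟨C.restrictScalars ℂ, isSubmodule_restrictScalars C,
    hC.map (Submodule.restrictScalarsLatticeHom ℂ W.modeAlgebra M)⟩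

theorem IsHom.map_socle_le {M' : Type*} [AddCommGroup M'] [Module ℂ M'] {W' : A.WeakModule M'}
    {f : M →ₗ[ℂ] M'} (hf : W.IsHom W' f) : W.socle.map f ≤ W'.socle := by
  rw [Submodule.map_le_iff_le_comap]
  refine sSup_le fun K hK => Submodule.map_le_iff_le_comap.mp ?_
  by_cases hbot : K.map f = ⊥
  · rw [hbot]
    exact bot_le
  · exact le_sSup (hf.isSimpleSubmodule_map hK hbot)

theorem IsHom.isCompletelyReducible_of_surjective {M' : Type*} [AddCommGroup M'] [Module ℂ M']
    {W' : A.WeakModule M'} {f : M →ₗ[ℂ] M'} (hf : W.IsHom W' f) (hsurj : Function.Surjective f)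
    (hW : W.IsCompletelyReducible) : W'.IsCompletelyReducible := by
  rw [isCompletelyReducible_iff_socle_eq_top] at hW ⊢
  have h := hf.map_socle_le
  rwa [hW, Submodule.map_top, LinearMap.range_eq_top.mpr hsurj, top_le_iff] at h

theorem IsCompletelyReducible.restrict (hW : W.IsCompletelyReducible) (K : Submodule ℂ M)
    (hK : W.IsSubmodule K) : (W.restrict K hK).IsCompletelyReducible := by
  obtain ⟨C, hC, hKC⟩ := hW.exists_isCompl hK
  have hproj : W.IsHom (W.restrict K hK) (K.projectionOnto C hKC) := by
    intro a n w
    obtain ⟨k, hk, c, hc, rfl⟩ := Submodule.mem_sup.mp (hKC.sup_eq_top ▸ Submodule.mem_top (x := w))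
    simp only [map_add, Submodule.projectionOnto_apply_of_mem_left hKC hk,
      Submodule.projectionOnto_apply_of_mem_left hKC (hK a n k hk),
      (Submodule.projectionOnto_apply_eq_zero_iff hKC).mpr hc,
      (Submodule.projectionOnto_apply_eq_zero_iff hKC).mpr (hC a n c hc), add_zero]
    rfl
  exact hproj.isCompletelyReducible_of_surjective
    (Submodule.projectionOnto_surjective hKC) hW

theorem isCompletelyReducible_of_iSup_eq_top {ι : Type*} {K : ι → Submodule ℂ M}
    (hK : ∀ i, W.IsSubmodule (K i)) (hred : ∀ i, (W.restrict (K i) (hK i)).IsCompletelyReducible)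
    (hsup : ⨆ i, K i = ⊤) : W.IsCompletelyReducible := by
  rw [isCompletelyReducible_iff_socle_eq_top, eq_top_iff, ← hsup]
  refine iSup_le fun i => ?_
  have h := (W.isHom_subtype (K i) (hK i)).map_socle_le
  rwa [isCompletelyReducible_iff_socle_eq_top.mp (hred i), Submodule.map_top,
    Submodule.range_subtype] at h

end Socle

section Cyclic

variable {M : Type v} [AddCommGroup M] [Module ℂ M] {W : A.WeakModule M}

/-- The submodule of `W` generated by the vector `x`. -/
def generatedBy (W : A.WeakModule M) (x : M) : Submodule ℂ M :=
  (Submodule.span W.modeAlgebra {x}).restrictScalars ℂ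

theorem isSubmodule_generatedBy (W : A.WeakModule M) (x : M) : W.IsSubmodule (W.generatedBy x) :=
  isSubmodule_restrictScalars _

theorem mem_generatedBy_self (W : A.WeakModule M) (x : M) : x ∈ W.generatedBy x :=
  Submodule.mem_span_singleton_self x

theorem generatedBy_le {K : Submodule ℂ M} (hK : W.IsSubmodule K) {x : M} (hx : x ∈ K) :
    W.generatedBy x ≤ K := by
  obtain ⟨L, rfl⟩ := hK.exists_restrictScalars_eq
  exact (Submodule.span_singleton_le_iff_mem x L).mpr hx

theorem generatedBy_restrict_generatedBy (W : A.WeakModule M) (x : M) :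
    (W.restrict _ (W.isSubmodule_generatedBy x)).generatedBy ⟨x, W.mem_generatedBy_self x⟩ = ⊤ := by
  set W' := W.restrict _ (W.isSubmodule_generatedBy x)
  have hsub := (W.isHom_subtype _ (W.isSubmodule_generatedBy x)).isSubmodule_map
    (W'.isSubmodule_generatedBy ⟨x, W.mem_generatedBy_self x⟩)
  apply Submodule.map_injective_of_injective (W.generatedBy x).injective_subtype
  rw [Submodule.map_top, Submodule.range_subtype]
  exact le_antisymm (Submodule.map_subtype_le _ _)
    (generatedBy_le hsub (Submodule.mem_map_of_mem (W'.mem_generatedBy_self _)))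

/-- The submodule `K` is maximal among the proper submodules of `W`. -/
def IsMaximalSubmodule (W : A.WeakModule M) (K : Submodule ℂ M) : Prop :=
  W.IsSubmodule K ∧ K ≠ ⊤ ∧ ∀ L, K ≤ L → W.IsSubmodule L → L = K ∨ L = ⊤

theorem isMaximalSubmodule_restrictScalars {L : Submodule W.modeAlgebra M} (hL : IsCoatom L) :
    W.IsMaximalSubmodule (L.restrictScalars ℂ) := by
  refine ⟨isSubmodule_restrictScalars L,
    fun h => hL.1 ((Submodule.restrictScalars_eq_top_iff ℂ _ M).mp h), fun K hle hK => ?_⟩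
  obtain ⟨L', rfl⟩ := hK.exists_restrictScalars_eq
  rcases hL.le_iff.mp hle with rfl | rfl
  · exact Or.inr (Submodule.restrictScalars_top ℂ _ M)
  · exact Or.inl rfl

theorem exists_isMaximalSubmodule_ge {x : M} (hx : W.generatedBy x = ⊤) {K : Submodule ℂ M}
    (hK : W.IsSubmodule K) (hne : K ≠ ⊤) : ∃ L, W.IsMaximalSubmodule L ∧ K ≤ L := by
  obtain ⟨K', rfl⟩ := hK.exists_restrictScalars_eq
  have : Module.Finite W.modeAlgebra M :=
    ⟨⟨{x}, by simpa using (Submodule.restrictScalars_eq_top_iff ℂ _ M).mp hx⟩⟩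
  obtain ⟨L, hL, hle⟩ := (eq_top_or_exists_le_coatom K').resolve_left fun h =>
    hne (by rw [h, Submodule.restrictScalars_top])
  exact ⟨_, isMaximalSubmodule_restrictScalars hL, hle⟩

theorem IsMaximalSubmodule.isSimple_quotient {K : Submodule ℂ M} (hK : W.IsMaximalSubmodule K) :
    (W.quotient K hK.1).IsSimple := by
  refine ⟨fun _ _ _ _ => trivial, fun htop => ?_, fun L _ hL => ?_⟩
  · exact hK.2.1 (Submodule.Quotient.subsingleton_iff.mp
      ((Submodule.subsingleton_iff ℂ).mp (subsingleton_of_bot_eq_top htop.symm)))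
  · rw [← Submodule.map_comap_eq_of_surjective K.mkQ_surjective L]
    rcases hK.2.2 _ (Submodule.le_comap_mkQ K L) ((W.isHom_mkQ K hK.1).isSubmodule_comap hL)
      with h | h
    · exact Or.inl (by rw [h, Submodule.mkQ_map_self])
    · exact Or.inr (by rw [h, Submodule.map_top, Submodule.range_mkQ])

end Cyclic

section WeightCoset

variable {M : Type v} [AddCommGroup M] [Module ℂ M] {W : A.WeakModule M}

/-- The sum of the weight spaces of `W` whose weights are congruent to `z` modulo `ℤ`. -/
def weightCoset (W : A.WeakModule M) (z : ℂ) : Submodule ℂ M := ⨆ n : ℤ, W.weightSpace (z + n)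

theorem weightSpace_le_weightCoset (W : A.WeakModule M) (z : ℂ) (n : ℤ) :
    W.weightSpace (z + n) ≤ W.weightCoset z :=
  le_iSup (fun n : ℤ => W.weightSpace (z + n)) n

theorem isSubmodule_weightCoset (W : A.WeakModule M) (z : ℂ) :
    W.IsSubmodule (W.weightCoset z) := by
  intro a n w hw
  have ha : a ∈ ⨆ k : ℤ, A.weightSpace k := A.grading.ge Submodule.mem_top
  induction ha using Submodule.iSup_induction' with
  | zero => simp
  | add a b _ _ ha hb => rw [map_add]; exact add_mem ha hb
  | mem k a ha =>
    induction hw using Submodule.iSup_induction' with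
    | zero => simp
    | add w x _ _ hw hx => rw [map_add]; exact add_mem hw hx
    | mem m w hw =>
      refine W.weightSpace_le_weightCoset z (m + k - n - 1) ?_
      convert W.mode_mem_weightSpace ha n hw using 2
      push_cast
      ring

theorem iSup_weightCoset (hW : W.IsOrdinary) : ⨆ z, W.weightCoset z = ⊤ := by
  rw [eq_top_iff, ← hW.grading]
  exact iSup_mono fun z => by simpa using W.weightSpace_le_weightCoset z 0

theorem weightCoset_restrict_weightCoset (W : A.WeakModule M) (z : ℂ) :
    (W.restrict _ (W.isSubmodule_weightCoset z)).weightCoset z = ⊤ := by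
  have hmap (n : ℤ) : ((W.restrict _ (W.isSubmodule_weightCoset z)).weightSpace (z + n)).map
      (W.weightCoset z).subtype = W.weightSpace (z + n) := by
    rw [weightSpace, map_eigenspace_of_injective (W.weightCoset z).injective_subtype
      (W.isHom_subtype _ _ A.omega 1), Submodule.range_subtype]
    exact inf_eq_right.mpr (W.weightSpace_le_weightCoset z n)
  apply Submodule.map_injective_of_injective (W.weightCoset z).injective_subtype
  refine (Submodule.map_iSup _ _).trans ?_
  rw [Submodule.map_top, Submodule.range_subtype]
  exact iSup_congr hmap

theorem add_intCast_add_injective (z : ℂ) (N : ℤ) :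
    Function.Injective fun n : ℤ => z + ((n + N : ℤ) : ℂ) :=
  (add_right_injective z).comp (Int.cast_injective.comp (add_left_injective N))

theorem IsOrdinary.exists_isAdmissible (hW : W.IsOrdinary) {z : ℂ} (hz : W.weightCoset z = ⊤) :
    ∃ N : ℤ, W.IsAdmissible fun n => W.weightSpace (z + (n + N : ℤ)) := by
  obtain ⟨N, hN⟩ := hW.lower_bound z
  refine ⟨N, ?_, fun n hn => hN (n + N) (by omega), fun k a ha m n w hw => ?_⟩
  · rw [DirectSum.isInternal_submodule_iff_iSupIndep_and_iSup_eq_top]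
    refine ⟨(Module.End.eigenspaces_iSupIndep _).comp (add_intCast_add_injective z N), ?_⟩
    rw [← hz]
    exact (Equiv.addRight N).iSup_comp (g := fun n : ℤ => W.weightSpace (z + n))
  · convert W.mode_mem_weightSpace ha m hw using 2
    push_cast
    ring

end WeightCoset

section VacuumLike

variable {M : Type v} [AddCommGroup M] [Module ℂ M] {W : A.WeakModule M}

/-- The vector `w` is vacuum-like: it is annihilated by `L(-1) = ω₀`. -/
def IsVacuumLike (W : A.WeakModule M) (w : M) : Prop := W.mode 0 A.omega w = 0

theorem IsVacuumLike.mode_eq_zero_of_nonneg {w : M} (hw : W.IsVacuumLike w) (a : V) {n : ℤ}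
    (hn : 0 ≤ n) : W.mode n a w = 0 := by
  obtain ⟨N, hN⟩ := W.truncation a w
  -- Applied to `w`, the commutator `[L(-1), a_{n+1}] = -(n+1) a_n` gives descent from large `n`.
  have hstep (n : ℤ) (hn : 0 ≤ n) (h : W.mode (n + 1) a w = 0) : W.mode n a w = 0 := by
    have hcomm := W.commutator_omega_zero a (n + 1) w
    rw [h, show W.mode 0 A.omega w = 0 from hw, map_zero, map_zero, sub_zero,
      add_sub_cancel_right, eq_comm, smul_eq_zero] at hcomm
    exact hcomm.resolve_left (neg_ne_zero.mpr (by exact_mod_cast (by omega : n + 1 ≠ 0)))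
  have hdescend : ∀ (j : ℕ) (n : ℤ), 0 ≤ n → N ≤ n + j → W.mode n a w = 0 := by
    intro j
    induction j with
    | zero => exact fun n _ h => hN n (by simpa using h)
    | succ j ih => exact fun n hn h => hstep n hn (ih (n + 1) (by omega) (by omega))
  exact hdescend (N - n).toNat n hn (by omega)

theorem IsVacuumLike.isHom {w : M} (hw : W.IsVacuumLike w) :
    A.regular.IsHom W ((W.mode (-1)).flip w) := by
  intro a n b
  change W.mode (-1) (A.mode n a b) w = W.mode n a (W.mode (-1) b w)
  rw [mode_mode, finsum_eq_single _ 0 fun i hi => by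
      rw [hw.mode_eq_zero_of_nonneg b (by omega), map_zero, smul_zero],
    finsum_eq_zero_of_forall_eq_zero fun i => by
      rw [hw.mode_eq_zero_of_nonneg a (by omega), map_zero, smul_zero]]
  simp

theorem IsVacuumLike.mem_socle {w : M} (hw : W.IsVacuumLike w) (hA : A.regular.IsSimple) :
    w ∈ W.socle := by
  have hmap : (W.mode (-1)).flip w A.vac = w := by simp [W.vacuum]
  have hvac : A.vac ∈ A.regular.socle := le_sSup (a := (⊤ : Submodule ℂ V)) hA Submodule.mem_top
  exact hw.isHom.map_socle_le ⟨A.vac, hvac, hmap⟩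

theorem exists_isVacuumLike_apply_eq_vac {U : Submodule ℂ V} {hU : A.IsSubalgebra U}
    (hWU : (W.restrictSubalgebra U hU).IsCompletelyReducible) {f : M →ₗ[ℂ] V}
    (hf : W.IsHom A.regular f) (hsurj : Function.Surjective f) :
    ∃ w, W.IsVacuumLike w ∧ f w = A.vac := by
  obtain ⟨D, hD, hcompl⟩ := hWU.exists_isCompl (hf.isSubmodule_ker.restrictSubalgebra U hU)
  obtain ⟨m, hm⟩ := hsurj A.vac
  obtain ⟨k, hk, d, hd, rfl⟩ := Submodule.mem_sup.mp
    (hcompl.sup_eq_top ▸ Submodule.mem_top (x := m))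
  have hfd : f d = A.vac := by rw [← hm, map_add, LinearMap.mem_ker.mp hk, zero_add]
  have hLker : W.mode 0 A.omega d ∈ LinearMap.ker f := by
    rw [LinearMap.mem_ker, hf, hfd]
    exact A.creation_nonneg _ _ le_rfl
  have hLD : W.mode 0 A.omega d ∈ D := hD ⟨A.omega, hU.omega_mem⟩ 0 d hd
  exact ⟨d, Submodule.disjoint_def.mp hcompl.disjoint _ hLker hLD, hfd⟩

end VacuumLike

section Rational

variable {M : Type u} [AddCommGroup M] [Module ℂ M] {W : A.WeakModule M}

theorem isCompletelyReducible_of_weightCoset_eq_top (hA : A.IsRational) (hW : W.IsOrdinary)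
    {z : ℂ} (hz : W.weightCoset z = ⊤) : W.IsCompletelyReducible := by
  obtain ⟨N, hN⟩ := hW.exists_isAdmissible hz
  obtain ⟨S, hS, hind, hsup⟩ := hA M W _ hN
  refine ⟨S, fun K hK => ?_, hind, hsup⟩
  obtain ⟨⟨hsub, -⟩, hne, hmin⟩ := hS K hK
  -- Every submodule is graded, being the sum of its eigenspaces for `L(0)`.
  refine ⟨hsub, hne, fun L hle hL => hmin L hle ⟨hL, ?_⟩⟩
  exact iSup_inf_eigenspace (add_intCast_add_injective z N)
    ((DirectSum.isInternal_submodule_iff_iSupIndep_and_iSup_eq_top _).mp hN.internal).2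
    (hL A.omega 1)

theorem IsOrdinary.isCompletelyReducible_of_isRational (hW : W.IsOrdinary) (hA : A.IsRational) :
    W.IsCompletelyReducible :=
  isCompletelyReducible_of_iSup_eq_top W.isSubmodule_weightCoset
    (fun z => isCompletelyReducible_of_weightCoset_eq_top hA
      (hW.restrict _ (W.isSubmodule_weightCoset z)) (W.weightCoset_restrict_weightCoset z))
    (iSup_weightCoset hW)

end Rational

section Holomorphic

variable {U : Submodule ℂ V} {hU : A.IsSubalgebra U}
  {M : Type u} [AddCommGroup M] [Module ℂ M] {W : A.WeakModule M}

theorem IsMaximalSubmodule.not_socle_le {K : Submodule ℂ M} (hK : W.IsMaximalSubmodule K)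
    (hA : A.IsHolomorphic) (hW : W.IsOrdinary)
    (hWU : (W.restrictSubalgebra U hU).IsCompletelyReducible) : ¬ W.socle ≤ K := by
  obtain ⟨e, he⟩ := hA.2 _ _ (hW.quotient K hK.1) hK.isSimple_quotient
  let f : M →ₗ[ℂ] V := e.toLinearMap ∘ₗ K.mkQ
  have hf : W.IsHom A.regular f := fun a n w => he a n (K.mkQ w)
  obtain ⟨w, hw, hfw⟩ :=
    exists_isVacuumLike_apply_eq_vac hWU hf (e.surjective.comp K.mkQ_surjective)
  intro hle
  have hmk : K.mkQ w = 0 := (Submodule.Quotient.mk_eq_zero K).mpr (hle (hw.mem_socle hA.1.2))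
  refine vac_ne_zero_of_isSimple hA.1.2 ?_
  rw [← hfw, LinearMap.comp_apply, hmk, map_zero]

theorem isCompletelyReducible_of_generatedBy_eq_top {x : M} (hx : W.generatedBy x = ⊤)
    (hA : A.IsHolomorphic) (hW : W.IsOrdinary)
    (hWU : (W.restrictSubalgebra U hU).IsCompletelyReducible) : W.IsCompletelyReducible := by
  rw [isCompletelyReducible_iff_socle_eq_top]
  by_contra hne
  obtain ⟨K, hK, hle⟩ := exists_isMaximalSubmodule_ge hx W.isSubmodule_socle hne
  exact hK.not_socle_le hA hW hWU hle

end Holomorphic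

end WeakModule

end VertexOperatorAlgebra

open VertexOperatorAlgebra.WeakModule in
theorem proposition9_general {V : Type u} [AddCommGroup V] [Module ℂ V]
    (A : VertexOperatorAlgebra V) (hA : A.IsHolomorphic)
    (U : Submodule ℂ V) (hU : A.IsSubalgebra U)
    {M : Type u} [AddCommGroup M] [Module ℂ M]
    (W : A.WeakModule M) (hW : W.IsOrdinary)
    (hWU : (W.restrictSubalgebra U hU).IsCompletelyReducible) :
    W.IsCompletelyReducible :=
  isCompletelyReducible_of_iSup_eq_top W.isSubmodule_generatedBy
    (fun x => isCompletelyReducible_of_generatedBy_eq_top (W.generatedBy_restrict_generatedBy x)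
      hA (hW.restrict _ (W.isSubmodule_generatedBy x))
      (hWU.restrict _ ((W.isSubmodule_generatedBy x).restrictSubalgebra U hU)))
    (eq_top_iff.mpr fun x _ => Submodule.mem_iSup_of_mem x (W.mem_generatedBy_self x))

theorem proposition9 {V : Type u} [AddCommGroup V] [Module ℂ V]
    (A : VertexOperatorAlgebra V) (hA : A.IsHolomorphic)
    (U : Submodule ℂ V) (hU : A.IsSubalgebra U) (hrat : (A.subalgebra U hU).IsRational)
    {M : Type u} [AddCommGroup M] [Module ℂ M]
    (W : A.WeakModule M) (hW : W.IsOrdinary) :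
    W.IsCompletelyReducible :=
  proposition9_general A hA U hU W hW
    ((hW.restrictSubalgebra U hU).isCompletelyReducible_of_isRational hrat)
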